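/- **Setting.** Let $f:\mathbb R^n\to\mathbb R^n$ be continuous and suppose that for every $x_0\in\mathbb R^n$ the system $\dot x=f(x)$, $x(0)=x_0$, has exactly one solution on $[0,\infty)$. Let $V:\mathbb R^n\to\mathbb R$ be locally Lipschitz. Its generalized gradient is $$\partial V(x)=\mathrm{co}\{\lim_{i\to\infty}\nabla V(x_i)\;:\;x_i\to x,\ x_i\notin Z\cup\Omega_V\},$$ where $\Omega_V$ is the set of points at which $V$ is not differentiable and $Z\subset\mathbb R^n$ is any set of Lebesgue measure zero; its set-valued Lie derivative is $\tilde L_fV(x)=\{\eta^Tf(x) : \eta\in\partial V(x)\}$. Assume that $V$ is regular, i.e. for all $x,v$ the one-sided directional derivative $\lim_{h\downarrow0}\frac{V(x+hv)-V(x)}h$ exists and equals $\limsup_{y\to x,\,h\downarrow0}\frac{V(y+hv)-V(y)}h$, and that every sublevel set $\{x: V(x)\le c\}$ is compact. Put $$M=\{x\in\mathbb R^n : 0\in\tilde L_fV(x)\}.$$ A set $S\subset\mathbb R^n$ is called invariant if every solution with $x(0)\in S$ satisfies $x(t)\in S$ for all $t\ge0$. Let $\phi:\mathbb R\to\mathbb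 R$ be continuous and monotonically increasing with $\phi(0)=0$, $r\phi(r)>0$ for $r\ne0$, and $\int_0^{V_0}\frac{dV}{\phi(V)}<\infty$ for all $V_0\in\mathbb R$. **Theorem.** Assume that for all $x\notin M$ $$V(x)\ge 0\qquad\text{and}\qquad \max\tilde L_fV(x)\le-\phi(V(x)).$$ For $x_0\in\mathbb R^n$ let $S=\{x : V(x)\le V(x_0)\}$ and let $E$ be the largest invariant subset of $M\cap S$. 1. If $V(x_0)>0$, then $S$ is invariant, and the solution starting from $x_0$ reaches $E$ in finite time and stays there: there is $T(x_0)\in\left[0,\int_0^{V(x_0)}\frac{dV}{\phi(V)}\right]$ such that $x(t)\in E$ for all $t\ge T(x_0)$. 2. If, furthermore, $V$ is radially unbounded with respect to $M$ (that is, $V(x)\to\infty$ as $\mathrm{dist}(x,M)\to\infty$) and $\sup_{V_0\in\mathbb R}\int_0^{V_0}\frac{dV}{\phi(V)}=T_M<\infty$, then for every $x_0\in\mathbb R^n$ the set $S$ is invariant and there is $T(x_0)\in[0,T_M]$ such that $x(t)\in E$ for all $t\ge T(x_0)$. -/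

import Mathlib

open Set Filter Topology MeasureTheory

namespace LaSalle

/-- `x` is a (classical) solution of `x' = f(x)` on `[0, ∞)`; values at negative times are
irrelevant. -/
def IsSolution {n : ℕ} (f : EuclideanSpace ℝ (Fin n) → EuclideanSpace ℝ (Fin n))
    (x : ℝ → EuclideanSpace ℝ (Fin n)) : Prop :=
  ∀ t, 0 ≤ t → HasDerivWithinAt x (f (x t)) (Ici 0) t

/-- For every initial condition there is exactly one solution on `[0, ∞)`. -/
def HasUniqueSolutions {n : ℕ}
    (f : EuclideanSpace ℝ (Fin n) → EuclideanSpace ℝ (Fin n)) : Prop :=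
  ∀ x₀, ∃ x, IsSolution f x ∧ x 0 = x₀ ∧
    ∀ y, IsSolution f y → y 0 = x₀ → EqOn y x (Ici 0)

/-- Every solution that starts in `S` stays in `S` for all `t ≥ 0`. -/
def IsInvariant {n : ℕ} (f : EuclideanSpace ℝ (Fin n) → EuclideanSpace ℝ (Fin n))
    (S : Set (EuclideanSpace ℝ (Fin n))) : Prop :=
  ∀ x, IsSolution f x → x 0 ∈ S → ∀ t, 0 ≤ t → x t ∈ S

/-- The largest invariant subset of `A`. -/
def largestInvariantSubset {n : ℕ}
    (f : EuclideanSpace ℝ (Fin n) → EuclideanSpace ℝ (Fin n))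
    (A : Set (EuclideanSpace ℝ (Fin n))) : Set (EuclideanSpace ℝ (Fin n)) :=
  ⋃₀ {B | B ⊆ A ∧ IsInvariant f B}

/-- The union above really is the greatest invariant subset of `A`. -/
theorem isGreatest_largestInvariantSubset {n : ℕ}
    (f : EuclideanSpace ℝ (Fin n) → EuclideanSpace ℝ (Fin n))
    (A : Set (EuclideanSpace ℝ (Fin n))) :
    IsGreatest {B | B ⊆ A ∧ IsInvariant f B} (largestInvariantSubset f A) := by
  refine ⟨⟨sUnion_subset fun B hB => hB.1, ?_⟩, fun B hB => subset_sUnion_of_mem hB⟩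
  rintro x hx ⟨B, hB, h0⟩ t ht
  exact ⟨B, hB, hB.2 x hx h0 t ht⟩

/-- Clarke's generalized directional derivative
`V°(x; v) = limsup_{y → x, h ↓ 0} (V (y + h v) - V y) / h`. -/
noncomputable def clarkeDeriv {n : ℕ} (V : EuclideanSpace ℝ (Fin n) → ℝ)
    (x v : EuclideanSpace ℝ (Fin n)) : ℝ :=
  limsup (fun p : EuclideanSpace ℝ (Fin n) × ℝ => (V (p.1 + p.2 • v) - V p.1) / p.2)
    (𝓝 x ×ˢ 𝓝[>] (0 : ℝ))

/-- Clarke regularity: all one-sided directional derivatives exist and coincide with the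
generalized ones. -/
def IsRegular {n : ℕ} (V : EuclideanSpace ℝ (Fin n) → ℝ) : Prop :=
  ∀ x v, Tendsto (fun h : ℝ => (V (x + h • v) - V x) / h) (𝓝[>] 0) (𝓝 (clarkeDeriv V x v))

/-- Clarke's generalized gradient `∂V(x)`: the convex hull of all limits of gradients of `V` along
sequences that converge to `x` and avoid `Z` and the points of non-differentiability of `V`
(for a null set `Z`). -/
def generalizedGradient {n : ℕ} (Z : Set (EuclideanSpace ℝ (Fin n)))
    (V : EuclideanSpace ℝ (Fin n) → ℝ) (x : EuclideanSpace ℝ (Fin n)) :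
    Set (EuclideanSpace ℝ (Fin n)) :=
  convexHull ℝ {g | ∃ u : ℕ → EuclideanSpace ℝ (Fin n),
    (∀ i, u i ∉ Z ∧ DifferentiableAt ℝ V (u i)) ∧
    Tendsto u atTop (𝓝 x) ∧ Tendsto (fun i => gradient V (u i)) atTop (𝓝 g)}

/-- The set-valued Lie derivative `{ηᵀ f(x) : η ∈ ∂V(x)}`. -/
def setLieDeriv {n : ℕ} (Z : Set (EuclideanSpace ℝ (Fin n)))
    (f : EuclideanSpace ℝ (Fin n) → EuclideanSpace ℝ (Fin n))
    (V : EuclideanSpace ℝ (Fin n) → ℝ) (x : EuclideanSpace ℝ (Fin n)) : Set ℝ :=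
  {a | ∃ η ∈ generalizedGradient Z V x, inner ℝ η (f x) = a}

/-- The set `M` of all `x` with `0` in the set-valued Lie derivative at `x`. -/
def zeroLieSet {n : ℕ} (Z : Set (EuclideanSpace ℝ (Fin n)))
    (f : EuclideanSpace ℝ (Fin n) → EuclideanSpace ℝ (Fin n))
    (V : EuclideanSpace ℝ (Fin n) → ℝ) : Set (EuclideanSpace ℝ (Fin n)) :=
  {x | 0 ∈ setLieDeriv Z f V x}

/-- `V(x) → ∞` as the distance from `x` to `M` tends to infinity. -/
def RadiallyUnboundedWrt {n : ℕ} (V : EuclideanSpace ℝ (Fin n) → ℝ)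
    (M : Set (EuclideanSpace ℝ (Fin n))) : Prop :=
  Tendsto V (comap (fun x => Metric.infDist x M) atTop) atTop

/-- The trajectory `x` is in `E` from some time `T ∈ [0, b]` on. -/
def SettlesWithin {n : ℕ} (x : ℝ → EuclideanSpace ℝ (Fin n))
    (E : Set (EuclideanSpace ℝ (Fin n))) (b : ℝ) : Prop :=
  ∃ T, 0 ≤ T ∧ T ≤ b ∧ ∀ t, T ≤ t → x t ∈ E

end LaSalle

/-! ### Clarke derivatives and generalized gradients. -/

namespace LaSalle

variable {n : ℕ} {V : EuclideanSpace ℝ (Fin n) → ℝ} {x v : EuclideanSpace ℝ (Fin n)}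

/-! `V°(x; ·)` is the support function of `∂V(x)` (`inner_le_clarkeDeriv`,
`exists_clarkeDeriv_le_inner`); Rademacher and Fubini make the null set `Z` harmless. For regular
`V`, the right and left derivatives of `V` along a solution are therefore the maximum and minimum of
the Lie derivative. On `M` the maximum may be positive, so monotonicity is read off the left
derivative, which is nonpositive everywhere; sublevel sets are thus invariant. Upper semicontinuity
of `V°` makes `M` closed.

A solution cannot leave `M`: at the last time in `M` the right derivative is nonnegative, yet the
decay just afterwards forces it to be negative. Before `M` is entered, the integral of `1 / φ` from
`0` to `V` falls at rate at least one, which bounds the entrance time (`exists_settling_time`). By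
uniqueness the tail of the orbit is an invariant subset of `M ∩ S`, hence part of `E`. -/

theorem _root_.LocallyLipschitz.exists_lipschitzOnWith_ball (hV : LocallyLipschitz V)
    (x : EuclideanSpace ℝ (Fin n)) :
    ∃ K : NNReal, ∃ r > 0, LipschitzOnWith K V (Metric.ball x r) := by
  obtain ⟨K, s, hs, hK⟩ := hV x
  obtain ⟨r, hr, hrs⟩ := Metric.mem_nhds_iff.1 hs
  exact ⟨K, r, hr, hK.mono hrs⟩

/-- Near `(x, 0+)`, the base point and the shifted point lie in any given neighbourhood of `x`. -/
theorem eventually_mem_and_shift_mem {s : Set (EuclideanSpace ℝ (Fin n))} (hs : s ∈ 𝓝 x)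
    (v : EuclideanSpace ℝ (Fin n)) :
    ∀ᶠ p : EuclideanSpace ℝ (Fin n) × ℝ in 𝓝 x ×ˢ 𝓝[>] (0 : ℝ),
      0 < p.2 ∧ p.1 ∈ s ∧ p.1 + p.2 • v ∈ s := by
  have hpos : ∀ᶠ p : EuclideanSpace ℝ (Fin n) × ℝ in 𝓝 x ×ˢ 𝓝[>] (0 : ℝ), 0 < p.2 :=
    tendsto_snd.eventually self_mem_nhdsWithin
  have hfst : ∀ᶠ p : EuclideanSpace ℝ (Fin n) × ℝ in 𝓝 x ×ˢ 𝓝[>] (0 : ℝ), p.1 ∈ s :=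
    tendsto_fst.eventually hs
  have hle : 𝓝 x ×ˢ 𝓝[>] (0 : ℝ) ≤ 𝓝 (x, (0 : ℝ)) := by
    rw [nhds_prod_eq]
    exact Filter.prod_mono le_rfl nhdsWithin_le_nhds
  have hcont : Tendsto (fun p : EuclideanSpace ℝ (Fin n) × ℝ => p.1 + p.2 • v)
      (𝓝 (x, (0 : ℝ))) (𝓝 x) := by
    have : Continuous fun p : EuclideanSpace ℝ (Fin n) × ℝ => p.1 + p.2 • v := by fun_prop
    simpa using this.tendsto (x, (0 : ℝ))
  filter_upwards [hpos, hfst, (hcont.mono_left hle).eventually hs] with p h₁ h₂ h₃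
  exact ⟨h₁, h₂, h₃⟩

/-- The local Lipschitz constant bounds the quotients. A real `limsup` is meaningful only with such
bounds. -/
theorem eventually_abs_quotient_le (hV : LocallyLipschitz V) (x v : EuclideanSpace ℝ (Fin n)) :
    ∃ C : ℝ, ∀ᶠ p : EuclideanSpace ℝ (Fin n) × ℝ in 𝓝 x ×ˢ 𝓝[>] (0 : ℝ),
      |(V (p.1 + p.2 • v) - V p.1) / p.2| ≤ C := by
  obtain ⟨K, r, hr, hK⟩ := hV.exists_lipschitzOnWith_ball x
  refine ⟨K * ‖v‖, ?_⟩
  filter_upwards [eventually_mem_and_shift_mem (Metric.ball_mem_nhds x hr) v] with p ⟨h₁, h₂, h₃⟩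
  have := hK.dist_le_mul _ h₃ _ h₂
  rw [Real.dist_eq, dist_eq_norm, add_sub_cancel_left, norm_smul, Real.norm_of_nonneg h₁.le] at this
  rw [abs_div, abs_of_pos h₁, div_le_iff₀ h₁]
  linarith

theorem isBoundedUnder_quotient (hV : LocallyLipschitz V) (x v : EuclideanSpace ℝ (Fin n)) :
    IsBoundedUnder (· ≤ ·) (𝓝 x ×ˢ 𝓝[>] (0 : ℝ))
      (fun p : EuclideanSpace ℝ (Fin n) × ℝ => (V (p.1 + p.2 • v) - V p.1) / p.2) := by
  obtain ⟨C, hC⟩ := eventually_abs_quotient_le hV x v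
  exact isBoundedUnder_of_eventually_le (hC.mono fun p hp => (abs_le.1 hp).2)

theorem isCoboundedUnder_quotient (hV : LocallyLipschitz V) (x v : EuclideanSpace ℝ (Fin n)) :
    IsCoboundedUnder (· ≤ ·) (𝓝 x ×ˢ 𝓝[>] (0 : ℝ))
      (fun p : EuclideanSpace ℝ (Fin n) × ℝ => (V (p.1 + p.2 • v) - V p.1) / p.2) := by
  obtain ⟨C, hC⟩ := eventually_abs_quotient_le hV x v
  exact (isBoundedUnder_of_eventually_ge
    (hC.mono fun p hp => (abs_le.1 hp).1)).isCoboundedUnder_le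

theorem eventually_quotient_lt (hV : LocallyLipschitz V) {c : ℝ} (h : clarkeDeriv V x v < c) :
    ∀ᶠ p : EuclideanSpace ℝ (Fin n) × ℝ in 𝓝 x ×ˢ 𝓝[>] (0 : ℝ),
      (V (p.1 + p.2 • v) - V p.1) / p.2 < c :=
  eventually_lt_of_limsup_lt h (isBoundedUnder_quotient hV x v)

theorem clarkeDeriv_le (hV : LocallyLipschitz V) {c : ℝ}
    (h : ∀ᶠ p : EuclideanSpace ℝ (Fin n) × ℝ in 𝓝 x ×ˢ 𝓝[>] (0 : ℝ),
      (V (p.1 + p.2 • v) - V p.1) / p.2 ≤ c) : clarkeDeriv V x v ≤ c :=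
  limsup_le_of_le (isCoboundedUnder_quotient hV x v) h

/-- Elements of the generalized gradient are dominated by the generalized derivative. -/
theorem inner_le_clarkeDeriv (hV : LocallyLipschitz V) {Z : Set (EuclideanSpace ℝ (Fin n))}
    {η : EuclideanSpace ℝ (Fin n)} (hη : η ∈ generalizedGradient Z V x)
    (v : EuclideanSpace ℝ (Fin n)) : inner ℝ η v ≤ clarkeDeriv V x v := by
  have hconv : Convex ℝ {η : EuclideanSpace ℝ (Fin n) | inner ℝ η v ≤ clarkeDeriv V x v} := by
    refine convex_halfSpace_le ⟨fun a b => ?_, fun c a => ?_⟩ _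
    · exact inner_add_left a b v
    · exact real_inner_smul_left a v c
  refine convexHull_min ?_ hconv hη
  rintro g ⟨u, hu, hux, hg⟩
  refine mem_ofPred.2 (le_of_forall_gt_imp_ge_of_dense fun c' hc' => ?_)
  have hlim : Tendsto (fun i => inner ℝ (gradient V (u i)) v) atTop (𝓝 (inner ℝ g v)) :=
    hg.inner tendsto_const_nhds
  refine le_of_tendsto hlim ?_
  -- Currying fixes the base point `u i` and leaves a bound for all small `h`, so `h ↓ 0` can be
  -- taken at `u i` alone.
  filter_upwards [hux.eventually (eventually_quotient_lt hV hc').curry] with i hi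
  have hd : HasLineDerivAt ℝ V (fderiv ℝ V (u i) v) (u i) v :=
    (hu i).2.hasFDerivAt.hasLineDerivAt v
  have hgrad : inner ℝ (gradient V (u i)) v = fderiv ℝ V (u i) v := by
    rw [gradient, InnerProductSpace.toDual_symm_apply]
  rw [hgrad]
  refine le_of_tendsto hd.tendsto_slope_zero_right ?_
  filter_upwards [hi] with h hh
  rw [smul_eq_mul, inv_mul_eq_div]
  exact hh.le

/-- A property that holds almost everywhere holds almost everywhere on almost every line
parallel to a given direction. -/
theorem ae_ae_add_smul {P : EuclideanSpace ℝ (Fin n) → Prop} (hP : ∀ᵐ z, P z)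
    (v : EuclideanSpace ℝ (Fin n)) : ∀ᵐ y : EuclideanSpace ℝ (Fin n), ∀ᵐ t : ℝ, P (y + t • v) := by
  obtain ⟨N, hPN, hN, hN0⟩ := exists_measurable_superset_of_null (ae_iff.1 hP)
  have hmeas : MeasurableSet {p : ℝ × EuclideanSpace ℝ (Fin n) | p.2 + p.1 • v ∉ N} := by
    have : Measurable fun p : ℝ × EuclideanSpace ℝ (Fin n) => p.2 + p.1 • v := by fun_prop
    exact this hN.compl
  have h : ∀ᵐ t : ℝ, ∀ᵐ y : EuclideanSpace ℝ (Fin n), y + t • v ∉ N := by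
    refine ae_of_all _ fun t => ?_
    rw [ae_iff]
    simp only [not_not]
    exact (measure_preimage_add_right volume (t • v) N).trans hN0
  have h' := (Measure.ae_ae_comm hmeas).1 h
  filter_upwards [h'] with y hy
  filter_upwards [hy] with t ht
  by_contra hPt
  exact ht (hPN hPt)

/-- If `⟪∇V, v⟫ ≤ c` off a null set in a ball, then `V` grows at rate at most `c` in the direction
`v` inside that ball. -/
theorem sub_le_of_inner_gradient_le {K : NNReal} {r c h : ℝ} {y : EuclideanSpace ℝ (Fin n)}
    {Z : Set (EuclideanSpace ℝ (Fin n))} (hZ : volume Z = 0)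
    (hK : LipschitzOnWith K V (Metric.ball x r))
    (hc : ∀ z ∈ Metric.ball x r, z ∉ Z → DifferentiableAt ℝ V z → inner ℝ (gradient V z) v ≤ c)
    (hh : 0 < h) (hy : y ∈ Metric.ball x r) (hyh : y + h • v ∈ Metric.ball x r) :
    V (y + h • v) - V y ≤ c * h := by
  have hgood : ∀ᵐ z : EuclideanSpace ℝ (Fin n), z ∈ Metric.ball x r →
      DifferentiableAt ℝ V z ∧ z ∉ Z := by
    filter_upwards [hK.ae_differentiableWithinAt_of_mem (μ := volume),
      measure_eq_zero_iff_ae_notMem.1 hZ] with z hz hzZ hzr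
    exact ⟨(hz hzr).differentiableAt (Metric.isOpen_ball.mem_nhds hzr), hzZ⟩
  -- For almost every `y` the segment meets the bad null set in a null set of times, so the
  -- fundamental theorem of calculus for Lipschitz functions applies on it.
  have hae : ∀ᵐ y : EuclideanSpace ℝ (Fin n), y ∈ Metric.ball x r →
      y + h • v ∈ Metric.ball x r → V (y + h • v) - V y ≤ c * h := by
    filter_upwards [ae_ae_add_smul hgood v] with y hline hy hyh
    have hmem : ∀ t ∈ Icc 0 h, y + t • v ∈ Metric.ball x r := by
      intro t ht
      have := (convex_ball x r).add_smul_sub_mem hy hyh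
        (t := t / h) ⟨by have := ht.1; positivity, (div_le_one hh).2 ht.2⟩
      rwa [add_sub_cancel_left, smul_smul, div_mul_cancel₀ _ hh.ne'] at this
    have hlip : LipschitzOnWith (K * ‖v‖₊) (fun t : ℝ => V (y + t • v)) (uIcc 0 h) := by
      rw [uIcc_of_le hh.le]
      refine hK.comp (g := V) (f := fun t : ℝ => y + t • v) ?_ hmem
      refine LipschitzOnWith.of_dist_le_mul fun s _ t _ => ?_
      rw [dist_add_left, dist_eq_norm, ← sub_smul, norm_smul, dist_eq_norm, mul_comm]
      rfl
    have hac := hlip.absolutelyContinuousOnInterval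
    have hftc := hac.integral_deriv_eq_sub
    simp only [zero_smul, add_zero] at hftc
    rw [← hftc]
    have hconst : ∫ _ in (0 : ℝ)..h, c = c * h := by simp [mul_comm]
    rw [← hconst]
    refine intervalIntegral.integral_mono_ae_restrict hh.le hac.intervalIntegrable_deriv
      intervalIntegrable_const ?_
    refine (ae_restrict_iff' measurableSet_Icc).2 ?_
    filter_upwards [hline] with t ht hth
    obtain ⟨hd, hz⟩ := ht (hmem t hth)
    have hder : HasDerivAt (fun t : ℝ => V (y + t • v)) (fderiv ℝ V (y + t • v) v) t := by
      have hl : HasDerivAt (fun t : ℝ => y + t • v) v t := by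
        simpa using ((hasDerivAt_id t).smul_const v).const_add y
      exact hd.hasFDerivAt.comp_hasDerivAt t hl
    rw [hder.deriv, ← InnerProductSpace.toDual_symm_apply (𝕜 := ℝ)]
    exact hc _ (hmem t hth) hz hd
  -- A strict violation at `y` would persist on a neighbourhood, which contains a point of the
  -- full-measure set.
  by_contra! hlt
  have hball := Metric.isOpen_ball (x := x) (ε := r)
  have hshift : ContinuousAt (fun y : EuclideanSpace ℝ (Fin n) => y + h • v) y := by fun_prop
  have hV₁ : ContinuousAt (fun y => V (y + h • v)) y :=
    ContinuousAt.comp (f := fun y : EuclideanSpace ℝ (Fin n) => y + h • v)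
      (hK.continuousOn.continuousAt (hball.mem_nhds hyh)) hshift
  have hV₂ : ContinuousAt V y := hK.continuousOn.continuousAt (hball.mem_nhds hy)
  have hev : ∀ᶠ y in 𝓝 y, y ∈ Metric.ball x r ∧ y + h • v ∈ Metric.ball x r ∧
      c * h < V (y + h • v) - V y :=
    Filter.Eventually.and (hball.mem_nhds hy) ((hshift.eventually (hball.mem_nhds hyh)).and
      ((hV₁.sub hV₂).eventually (lt_mem_nhds hlt)))
  obtain ⟨z, hz, h₁, h₂, h₃⟩ :=
    ((Measure.dense_of_ae hae).inter_nhds_nonempty hev)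
  exact absurd (hz h₁ h₂) (not_le.2 h₃)

/-- The generalized derivative is attained on the generalized gradient. -/
theorem exists_clarkeDeriv_le_inner (hV : LocallyLipschitz V)
    {Z : Set (EuclideanSpace ℝ (Fin n))} (hZ : volume Z = 0) (x v : EuclideanSpace ℝ (Fin n)) :
    ∃ η ∈ generalizedGradient Z V x, clarkeDeriv V x v ≤ inner ℝ η v := by
  obtain ⟨K, r, hr, hK⟩ := hV.exists_lipschitzOnWith_ball x
  have happrox : ∀ ε > 0, ∃ z ∈ Metric.ball x (min r ε), z ∉ Z ∧ DifferentiableAt ℝ V z ∧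
      clarkeDeriv V x v - ε < inner ℝ (gradient V z) v := by
    intro ε hε
    -- If all nearby gradients stayed `ε` below, integration along segments would lower `V°` itself
    -- by `ε`.
    by_contra! hcon
    have hr' : 0 < min r ε := lt_min hr hε
    have : clarkeDeriv V x v ≤ clarkeDeriv V x v - ε := by
      refine clarkeDeriv_le hV ?_
      filter_upwards [eventually_mem_and_shift_mem (Metric.ball_mem_nhds x hr') v]
        with p ⟨h₁, h₂, h₃⟩
      rw [div_le_iff₀ h₁]
      exact sub_le_of_inner_gradient_le hZ
        (hK.mono (Metric.ball_subset_ball (min_le_left r ε))) hcon h₁ h₂ h₃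
    linarith
  have hpos (k : ℕ) : (0 : ℝ) < 1 / ((k : ℝ) + 1) := Nat.one_div_pos_of_nat
  choose u hu huZ hud hui using fun k : ℕ => happrox _ (hpos k)
  have hbdd (k : ℕ) : gradient V (u k) ∈ Metric.closedBall (0 : EuclideanSpace ℝ (Fin n)) K := by
    rw [mem_closedBall_zero_iff, gradient, LinearIsometryEquiv.norm_map]
    exact norm_fderiv_le_of_lipschitzOn ℝ (Metric.isOpen_ball.mem_nhds
      (Metric.ball_subset_ball (min_le_left _ _) (hu k))) hK
  obtain ⟨g, -, ψ, hψ, hg⟩ := (isCompact_closedBall _ _).tendsto_subseq hbdd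
  have hux : Tendsto u atTop (𝓝 x) := by
    rw [tendsto_iff_dist_tendsto_zero]
    refine squeeze_zero (fun _ => dist_nonneg) (fun k => ?_)
      (tendsto_one_div_add_atTop_nhds_zero_nat (𝕜 := ℝ))
    exact (Metric.mem_ball.1 (hu k)).le.trans (min_le_right _ _)
  refine ⟨g, subset_convexHull ℝ _ ⟨u ∘ ψ, fun i => ⟨huZ _, hud _⟩,
    hux.comp hψ.tendsto_atTop, hg⟩, ?_⟩
  have hlow : Tendsto (fun i => clarkeDeriv V x v - 1 / ((ψ i : ℝ) + 1)) atTop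
      (𝓝 (clarkeDeriv V x v - 0)) :=
    tendsto_const_nhds.sub
      ((tendsto_one_div_add_atTop_nhds_zero_nat (𝕜 := ℝ)).comp hψ.tendsto_atTop)
  rw [sub_zero] at hlow
  exact le_of_tendsto_of_tendsto' hlow (hg.inner tendsto_const_nhds) fun i => (hui (ψ i)).le

/-- Upper semicontinuity of the generalized derivative, jointly in the point and the direction. -/
theorem eventually_clarkeDeriv_lt (hV : LocallyLipschitz V) {c : ℝ}
    (h : clarkeDeriv V x v < c) :
    ∀ᶠ q : EuclideanSpace ℝ (Fin n) × EuclideanSpace ℝ (Fin n) in 𝓝 (x, v),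
      clarkeDeriv V q.1 q.2 < c := by
  -- The gap up to `c₁` absorbs moving the base point, the gap from `c₁` to `c₂` absorbs changing
  -- the direction, and `c₂ < c` keeps strictness through the limsup.
  obtain ⟨c₁, h₁, hc₁⟩ := exists_between h
  obtain ⟨c₂, hc₁₂, hc₂⟩ := exists_between hc₁
  obtain ⟨K, r, hr, hK⟩ := hV.exists_lipschitzOnWith_ball x
  have hquot := (eventually_quotient_lt hV h₁)
  rw [eventually_prod_iff] at hquot
  obtain ⟨P, hP, Q, hQ, hPQ⟩ := hquot
  have hdir : ∀ᶠ w in 𝓝 v, K * ‖w - v‖ < c₂ - c₁ := by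
    have : Continuous fun w : EuclideanSpace ℝ (Fin n) => (K : ℝ) * ‖w - v‖ := by fun_prop
    refine this.continuousAt.eventually (gt_mem_nhds ?_)
    simpa using hc₁₂
  rw [nhds_prod_eq]
  refine (hP.eventually_nhds.and (Metric.ball_mem_nhds x hr)).prod_mk hdir |>.mono ?_
  rintro ⟨z, w⟩ ⟨⟨hz, hzr⟩, hw⟩
  refine lt_of_le_of_lt (clarkeDeriv_le hV ?_) hc₂
  have hzb := Metric.isOpen_ball.mem_nhds hzr
  filter_upwards [eventually_mem_and_shift_mem hzb v, eventually_mem_and_shift_mem hzb w,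
    hz.prod_mk hQ] with p ⟨hp, _, hpv⟩ ⟨_, _, hpw⟩ ⟨hp₁, hp₂⟩
  have hq := hPQ hp₁ hp₂
  rw [div_lt_iff₀ hp] at hq
  have hd := hK.dist_le_mul _ hpw _ hpv
  rw [Real.dist_eq, dist_add_left, dist_eq_norm, ← smul_sub, norm_smul,
    Real.norm_of_nonneg hp.le] at hd
  rw [div_le_iff₀ hp]
  have := (abs_le.1 hd).2
  have hw' : (p.2 : ℝ) * (K * ‖w - v‖) ≤ p.2 * (c₂ - c₁) := by gcongr
  nlinarith

/-! ### One-sided derivatives along curves. -/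

/-- For regular `V`, the generalized derivative is the right derivative of `V` along a curve. -/
theorem IsRegular.hasDerivWithinAt_Ici_comp (hreg : IsRegular V) (hV : LocallyLipschitz V)
    {γ : ℝ → EuclideanSpace ℝ (Fin n)} {t : ℝ} (hγ : HasDerivWithinAt γ v (Ici t) t) :
    HasDerivWithinAt (fun s => V (γ s)) (clarkeDeriv V (γ t) v) (Ici t) t := by
  obtain ⟨K, r, hr, hK⟩ := hV.exists_lipschitzOnWith_ball (γ t)
  have hγ' := hγ.Ioi_of_Ici
  rw [hasDerivWithinAt_Ioi_iff_Ici.symm, hasDerivWithinAt_iff_tendsto_slope' self_notMem_Ioi]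
  rw [hasDerivWithinAt_iff_tendsto_slope' self_notMem_Ioi] at hγ'
  have hshift : Tendsto (fun s => s - t) (𝓝[>] t) (𝓝[>] 0) := by
    refine tendsto_nhdsWithin_iff.2 ⟨?_, ?_⟩
    · have : Continuous fun s : ℝ => s - t := by fun_prop
      simpa using (this.tendsto t).mono_left nhdsWithin_le_nhds
    · filter_upwards [self_mem_nhdsWithin] with s hs using sub_pos.2 (mem_Ioi.1 hs)
  have hmain := (hreg (γ t) v).comp hshift
  have hball := Metric.ball_mem_nhds (γ t) hr
  have hin₁ : ∀ᶠ s in 𝓝[>] t, γ s ∈ Metric.ball (γ t) r :=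
    (hγ.continuousWithinAt.mono Ioi_subset_Ici_self).eventually hball
  have hin₂ : ∀ᶠ s in 𝓝[>] t, γ t + (s - t) • v ∈ Metric.ball (γ t) r := by
    have : Continuous fun s : ℝ => γ t + (s - t) • v := by fun_prop
    have h := (this.tendsto t).mono_left (nhdsWithin_le_nhds (s := Ioi t))
    simp only [sub_self, zero_smul, add_zero] at h
    exact h.eventually hball
  have herr : Tendsto (fun s => K * ‖slope γ t s - v‖) (𝓝[>] t) (𝓝 0) := by
    simpa using ((hγ'.sub_const v).norm.const_mul (K : ℝ))
  -- Replacing the curve by its tangent ray changes the quotient by at most `K * ‖slope - v‖`.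
  have hdiff : Tendsto (fun s => slope (fun s => V (γ s)) t s -
      (V (γ t + (s - t) • v) - V (γ t)) / (s - t)) (𝓝[>] t) (𝓝 0) := by
    refine squeeze_zero_norm' ?_ herr
    filter_upwards [hin₁, hin₂, self_mem_nhdsWithin] with s h₁ h₂ hs
    have hs' : 0 < s - t := sub_pos.2 hs
    have hd := hK.dist_le_mul _ h₁ _ h₂
    have hvec : γ s - (γ t + (s - t) • v) = (s - t) • (slope γ t s - v) := by
      rw [smul_sub, slope_def_module, smul_smul, mul_inv_cancel₀ hs'.ne', one_smul]
      abel
    rw [Real.dist_eq, dist_eq_norm, hvec, norm_smul, Real.norm_of_nonneg hs'.le] at hd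
    rw [slope_def_field, ← sub_div, sub_sub_sub_cancel_right, Real.norm_eq_abs, abs_div,
      abs_of_pos hs', div_le_iff₀ hs']
    linarith
  simpa using hmain.add hdiff

/-- The left derivative of a regular function along a curve. -/
theorem IsRegular.hasDerivWithinAt_Iic_comp (hreg : IsRegular V) (hV : LocallyLipschitz V)
    {γ : ℝ → EuclideanSpace ℝ (Fin n)} {t : ℝ} (hγ : HasDerivWithinAt γ v (Iic t) t) :
    HasDerivWithinAt (fun s => V (γ s)) (-clarkeDeriv V (γ t) (-v)) (Iic t) t := by
  have hneg (a : ℝ) (s : Set ℝ) : HasDerivWithinAt (fun s : ℝ => -s) (-1) s a :=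
    (hasDerivAt_neg a).hasDerivWithinAt
  have hrev : HasDerivWithinAt (fun s => γ (-s)) (-v) (Ici (-t)) (-t) := by
    have hγ' : HasDerivWithinAt γ v (Iic t) (-(-t)) := by rwa [neg_neg]
    simpa [Function.comp_def] using hγ'.scomp (-t) (hneg (-t) (Ici (-t))) fun s hs => neg_le.1 (mem_Ici.1 hs)
  have h := hreg.hasDerivWithinAt_Ici_comp hV hrev
  simp only [neg_neg] at h
  have h' := h.scomp t (hneg t (Iic t)) fun s hs => neg_le_neg (mem_Iic.1 hs)
  simpa [Function.comp_def] using h'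

end LaSalle

/-! ### Scalar comparison and settling time. -/

namespace LaSalle

/-- A real function with nonpositive left derivatives on `(a, b]` satisfies `W b ≤ W a`. -/
theorem le_of_left_deriv_nonpos {W q : ℝ → ℝ} {a b : ℝ} (hab : a ≤ b)
    (hc : ContinuousOn W (Icc a b))
    (hd : ∀ t ∈ Ioc a b, HasDerivWithinAt W (q t) (Iic t) t) (hq : ∀ t ∈ Ioc a b, q t ≤ 0) :
    W b ≤ W a := by
  have hmaps : MapsTo (fun s : ℝ => -s) (Icc (-b) (-a)) (Icc a b) := fun s hs =>
    ⟨le_neg.1 hs.2, neg_le.1 hs.1⟩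
  have hneg : ContinuousOn (fun s => -W (-s)) (Icc (-b) (-a)) :=
    (hc.comp (f := fun s : ℝ => -s) continuous_neg.continuousOn hmaps).neg
  have hder : ∀ s ∈ Ico (-b) (-a), HasDerivWithinAt (fun s => -W (-s)) (q (-s)) (Ici s) s := by
    intro s hs
    have h₁ := hd (-s) ⟨lt_neg.1 hs.2, neg_le.1 hs.1⟩
    have h₂ := h₁.scomp s (hasDerivAt_neg s).hasDerivWithinAt
      (fun u hu => neg_le_neg (mem_Ici.1 hu))
    have h₃ := h₂.neg
    rw [neg_one_smul, neg_neg] at h₃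
    exact h₃
  have := image_le_of_deriv_right_le_deriv_boundary (B := fun _ => -W (-(-b))) (B' := fun _ => 0)
    hneg hder le_rfl continuousOn_const (fun _ _ => hasDerivWithinAt_const _ _ _)
    (fun s hs => hq (-s) ⟨lt_neg.1 hs.2, neg_le.1 hs.1⟩) (right_mem_Icc.2 (neg_le_neg hab))
  simpa using this

/-- If the right derivatives of `W` on `[a, b)` are at most `c`, then `W b ≤ W a + c (b - a)`. -/
theorem le_add_of_right_deriv_le {W p : ℝ → ℝ} {a b c : ℝ} (hab : a ≤ b)
    (hc : ContinuousOn W (Icc a b))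
    (hd : ∀ t ∈ Ico a b, HasDerivWithinAt W (p t) (Ici t) t) (hp : ∀ t ∈ Ico a b, p t ≤ c) :
    W b ≤ W a + c * (b - a) := by
  refine image_le_of_deriv_right_le_deriv_boundary (B := fun t => W a + c * (t - a))
    (B' := fun _ => c) hc hd (by simp) (by fun_prop) (fun t _ => ?_) hp (right_mem_Icc.2 hab)
  simpa using ((((hasDerivAt_id t).sub_const a).const_mul c).const_add (W a)).hasDerivWithinAt

/-- The settling-time function `∫₀ᶜ dr / φ(r)` is nonnegative. -/
theorem settling_integral_nonneg {φ : ℝ → ℝ} (hφsign : ∀ r, r ≠ 0 → 0 < r * φ r)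
    (hφ0 : φ 0 = 0) (c : ℝ) : 0 ≤ ∫ r in (0 : ℝ)..c, 1 / φ r := by
  rcases le_total 0 c with hc | hc
  · refine intervalIntegral.integral_nonneg hc fun r hr => ?_
    rcases hr.1.eq_or_lt with h | h
    -- At `r = 0` the integrand is `1 / 0 = 0`.
    · simp [← h, hφ0]
    · exact (one_div_pos.2 (pos_of_mul_pos_right (hφsign r h.ne') h.le)).le
  · rw [intervalIntegral.integral_symm, ← intervalIntegral.integral_neg]
    refine intervalIntegral.integral_nonneg hc fun r hr => neg_nonneg.2 ?_
    rcases hr.2.eq_or_lt with h | h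
    · simp [h, hφ0]
    · exact (one_div_neg.2 (neg_of_mul_pos_right (hφsign r h.ne) h.le)).le

/-- Away from zero the integrand is continuous; the possible singularity at `0` enters only through
integrability. -/
theorem hasDerivAt_settling_integral {φ : ℝ → ℝ} (hφcont : Continuous φ)
    (hφsign : ∀ r, r ≠ 0 → 0 < r * φ r)
    (hφint : ∀ c : ℝ, IntervalIntegrable (fun r => 1 / φ r) volume 0 c) {c : ℝ} (hc : 0 < c) :
    HasDerivAt (fun c => ∫ r in (0 : ℝ)..c, 1 / φ r) (1 / φ c) c := by
  have hne : φ c ≠ 0 := right_ne_zero_of_mul (hφsign c hc.ne').ne'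
  refine intervalIntegral.integral_hasDerivAt_right (hφint c) ?_
    (continuousAt_const.div hφcont.continuousAt hne)
  exact (Measurable.stronglyMeasurable (by fun_prop)).stronglyMeasurableAtFilter

/-- As long as `W > 0` decreases at rate at least `φ(W)`, the elapsed time is bounded by the
settling-time integral. -/
theorem le_settling_integral {φ W p : ℝ → ℝ} (hφcont : Continuous φ)
    (hφsign : ∀ r, r ≠ 0 → 0 < r * φ r) (hφ0 : φ 0 = 0)
    (hφint : ∀ c : ℝ, IntervalIntegrable (fun r => 1 / φ r) volume 0 c) {t : ℝ} (ht : 0 ≤ t)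
    (hc : ContinuousOn W (Icc 0 t))
    (hd : ∀ s ∈ Ico 0 t, HasDerivWithinAt W (p s) (Ici s) s)
    (hW : ∀ s ∈ Icc 0 t, 0 < W s) (hp : ∀ s ∈ Ico 0 t, p s ≤ -φ (W s)) :
    t ≤ ∫ r in (0 : ℝ)..W 0, 1 / φ r := by
  have hG {c : ℝ} (hc : 0 < c) := hasDerivAt_settling_integral hφcont hφsign hφint hc
  have h := le_add_of_right_deriv_le (W := fun s => ∫ r in (0 : ℝ)..W s, 1 / φ r)
    (p := fun s => 1 / φ (W s) * p s) (c := -1) ht ?_ ?_ ?_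
  · have := settling_integral_nonneg hφsign hφ0 (W t)
    linarith
  · exact fun s hs => (hG (hW s hs)).continuousAt.comp_continuousWithinAt (hc s hs)
  · exact fun s hs => (hG (hW s (Ico_subset_Icc_self hs))).comp_hasDerivWithinAt s (hd s hs)
  · intro s hs
    have hWs := hW s (Ico_subset_Icc_self hs)
    have hφs : 0 < φ (W s) := pos_of_mul_pos_right (hφsign _ hWs.ne') hWs.le
    rw [one_div_mul_eq_div, div_le_iff₀ hφs]
    linarith [hp s hs]

/-- Finite-time entrance for a scalar function `W` and a closed set `A` of times: if `W` is
nonincreasing, its right derivative is nonnegative on `A`, and off `A` it is negative and at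
most `-φ(W)`, then `A` contains all times from some `T ≤ ∫ dr / φ(r)` on. -/
theorem exists_settling_time {φ W p : ℝ → ℝ} {A : Set ℝ} (hφmono : Monotone φ)
    (hφcont : Continuous φ) (hφsign : ∀ r, r ≠ 0 → 0 < r * φ r) (hφ0 : φ 0 = 0)
    (hφint : ∀ c : ℝ, IntervalIntegrable (fun r => 1 / φ r) volume 0 c)
    (hanti : AntitoneOn W (Ici 0)) (hc : ContinuousOn W (Ici 0))
    (hd : ∀ t, 0 ≤ t → HasDerivWithinAt W (p t) (Ici t) t)
    (hA : ∀ t ∈ A, 0 ≤ p t) (hA₀ : A ⊆ Ici 0) (hclosed : IsClosed A)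
    (hneg : ∀ t, 0 ≤ t → t ∉ A → p t < 0) (hle : ∀ t, 0 ≤ t → t ∉ A → p t ≤ -φ (W t))
    (hWnonneg : ∀ t, 0 ≤ t → t ∉ A → 0 ≤ W t) :
    ∃ T, 0 ≤ T ∧ T ≤ ∫ r in (0 : ℝ)..W 0, 1 / φ r ∧ ∀ t, T ≤ t → t ∈ A := by
  -- A zero of `W` off `A` would be followed at once by negative values, at times still off `A`
  -- because `A` is closed.
  have hWpos : ∀ t, 0 ≤ t → t ∉ A → 0 < W t := by
    intro t ht htA
    refine (hWnonneg t ht htA).lt_of_ne fun h0 => ?_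
    have hslope := (hasDerivWithinAt_iff_tendsto_slope' self_notMem_Ioi).1 (hd t ht).Ioi_of_Ici
    have hout : ∀ᶠ s in 𝓝[>] t, s ∉ A :=
      nhdsWithin_le_nhds (hclosed.isOpen_compl.mem_nhds htA)
    obtain ⟨s, hs₁, hs₂, hs₃⟩ := ((hslope.eventually (gt_mem_nhds (hneg t ht htA))).and
      (hout.and self_mem_nhdsWithin)).exists
    have hts : 0 < s - t := sub_pos.2 (mem_Ioi.1 hs₃)
    rw [slope_def_field, ← h0, sub_zero, div_lt_iff₀ hts, zero_mul] at hs₁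
    exact absurd (hWnonneg s (by linarith) hs₂) (not_le.2 hs₁)
  have hstay : ∀ s ∈ A, ∀ t, s ≤ t → t ∈ A := by
    intro s₀ hs₀ t hst
    by_contra htA
    have ht0 : 0 ≤ t := (mem_Ici.1 (hA₀ hs₀)).trans hst
    set B := A ∩ Iic t
    have hBbdd : BddAbove B := ⟨t, fun u hu => hu.2⟩
    have hsB : sSup B ∈ B := (hclosed.inter isClosed_Iic).csSup_mem ⟨s₀, hs₀, hst⟩ hBbdd
    set s := sSup B
    have hs0 : 0 ≤ s := hA₀ hsB.1
    have hlt : s < t := hsB.2.lt_of_ne fun h => htA (h ▸ hsB.1)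
    have hout : ∀ u ∈ Ioc s t, u ∉ A := fun u hu huA =>
      absurd (le_csSup hBbdd ⟨huA, hu.2⟩) (not_le.2 hu.1)
    have hWt := hWpos t ht0 htA
    have hφt : 0 < φ (W t) := pos_of_mul_pos_right (hφsign _ hWt.ne') hWt.le
    have hrate : ∀ u ∈ Ioc s t, W u - W s ≤ -φ (W t) * (u - s) := by
      intro u hu
      -- The decay bound is unavailable at `s ∈ A` itself, so start at `v > s` and let `v ↓ s`.
      -- Monotonicity of `W` and `φ` makes the rate `φ (W t)` uniform.
      have hbound : ∀ v ∈ Ioc s u, W u ≤ W v - φ (W t) * (u - v) := by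
        intro v hv
        have hv0 : 0 ≤ v := hs0.trans hv.1.le
        have := le_add_of_right_deriv_le (c := -φ (W t)) hv.2
          (hc.mono fun w hw => hv0.trans hw.1) (fun w hw => hd w (hv0.trans hw.1)) fun w hw => by
            have hw0 : 0 ≤ w := hv0.trans hw.1
            have hwt : w ≤ t := hw.2.le.trans hu.2
            refine (hle w hw0 (hout w ⟨hv.1.trans_le hw.1, hwt⟩)).trans (neg_le_neg ?_)
            exact hφmono (hanti hw0 ht0 hwt)
        linarith
      have hlim : Tendsto (fun v => W v - φ (W t) * (u - v)) (𝓝[>] s)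
          (𝓝 (W s - φ (W t) * (u - s))) := by
        have h₁ : Tendsto W (𝓝[>] s) (𝓝 (W s)) :=
          (hd s hs0).continuousWithinAt.mono Ioi_subset_Ici_self
        have h₂ : Continuous fun v => φ (W t) * (u - v) := by fun_prop
        exact h₁.sub ((h₂.tendsto s).mono_left nhdsWithin_le_nhds)
      have := ge_of_tendsto hlim (by
        filter_upwards [Ioc_mem_nhdsGT hu.1] with v hv using hbound v hv)
      linarith
    have hslope := (hasDerivWithinAt_iff_tendsto_slope' self_notMem_Ioi).1 (hd s hs0).Ioi_of_Ici
    have : p s ≤ -φ (W t) := le_of_tendsto hslope (by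
      filter_upwards [Ioc_mem_nhdsGT hlt] with u hu
      rw [slope_def_field, div_le_iff₀ (sub_pos.2 hu.1)]
      exact hrate u hu)
    linarith [hA s hsB.1]
  have hbound : ∀ t, 0 ≤ t → t ∉ A → t ≤ ∫ r in (0 : ℝ)..W 0, 1 / φ r := by
    intro t ht htA
    have hout : ∀ s ∈ Icc 0 t, s ∉ A := fun s hs hsA => htA (hstay s hsA t hs.2)
    exact le_settling_integral hφcont hφsign hφ0 hφint ht (hc.mono Icc_subset_Ici_self)
      (fun s hs => hd s hs.1) (fun s hs => hWpos s hs.1 (hout s hs))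
      fun s hs => hle s hs.1 (hout s (Ico_subset_Icc_self hs))
  have hGnonneg := settling_integral_nonneg hφsign hφ0 (W 0)
  have hbelow : BddBelow A := ⟨0, fun t ht => hA₀ ht⟩
  have hne : A.Nonempty := by
    by_contra! hempty
    have := hbound ((∫ r in (0 : ℝ)..W 0, 1 / φ r) + 1) (by linarith) (by simp [hempty])
    linarith
  have hT := hclosed.csInf_mem hne hbelow
  -- Every nonnegative time below `sInf A` is off `A`, hence at most the integral.
  refine ⟨sInf A, hA₀ hT, le_of_forall_lt fun t ht => ?_, hstay _ hT⟩
  obtain ⟨u, htu, huT⟩ := exists_between ht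
  rcases lt_or_ge u 0 with hu | hu
  · linarith
  · exact htu.trans_le (hbound u hu fun huA => absurd (csInf_le hbelow huA) (not_le.2 huT))

/-! ### Solutions, invariant sets and the Lie derivative. -/

variable {n : ℕ} {f : EuclideanSpace ℝ (Fin n) → EuclideanSpace ℝ (Fin n)}
  {x : ℝ → EuclideanSpace ℝ (Fin n)}

theorem IsSolution.continuousOn (hx : IsSolution f x) : ContinuousOn x (Ici 0) :=
  fun t ht => (hx t ht).continuousWithinAt

theorem IsSolution.hasDerivWithinAt_Iic (hx : IsSolution f x) {t : ℝ} (ht : 0 < t) :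
    HasDerivWithinAt x (f (x t)) (Iic t) t :=
  ((hx t ht.le).hasDerivAt (Ici_mem_nhds ht)).hasDerivWithinAt

/-- Time translates of solutions are solutions. -/
theorem IsSolution.shift (hx : IsSolution f x) {s : ℝ} (hs : 0 ≤ s) :
    IsSolution f fun t => x (s + t) := by
  intro t ht
  have h := (hx (s + t) (add_nonneg hs ht)).scomp t
    (((hasDerivAt_id t).const_add s).hasDerivWithinAt (s := Ici 0))
    (fun u hu => add_nonneg hs (mem_Ici.1 hu))
  simpa [Function.comp_def] using h

/-- Two solutions that agree at time zero agree at all later times. -/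
theorem HasUniqueSolutions.eqOn (hsol : HasUniqueSolutions f)
    {y : ℝ → EuclideanSpace ℝ (Fin n)} (hx : IsSolution f x) (hy : IsSolution f y)
    (h : y 0 = x 0) : EqOn y x (Ici 0) := by
  obtain ⟨z, -, -, hz⟩ := hsol (x 0)
  exact (hz y hy h).trans (hz x hx rfl).symm

/-- A trajectory that stays in `A` from time `T` on is in the largest invariant subset of `A`
from time `T` on. -/
theorem IsSolution.mem_largestInvariantSubset (hsol : HasUniqueSolutions f)
    (hx : IsSolution f x) {A : Set (EuclideanSpace ℝ (Fin n))} {T : ℝ} (hT : 0 ≤ T)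
    (hA : ∀ t, T ≤ t → x t ∈ A) {t : ℝ} (ht : T ≤ t) : x t ∈ largestInvariantSubset f A := by
  -- The tail of the orbit is the witness; uniqueness identifies any solution starting on it with a
  -- time translate of `x`.
  refine ⟨x '' Ici T, ⟨?_, ?_⟩, mem_image_of_mem x ht⟩
  · rintro _ ⟨s, hs, rfl⟩
    exact hA s hs
  · rintro y hy ⟨s, hs, hsy⟩ u hu
    have hs' : T ≤ s := hs
    have := hsol.eqOn (hx.shift (hT.trans hs')) hy (by simpa using hsy.symm) (mem_Ici.2 hu)
    exact ⟨s + u, mem_Ici.2 (by linarith), this.symm⟩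

variable {Z : Set (EuclideanSpace ℝ (Fin n))} {V : EuclideanSpace ℝ (Fin n) → ℝ}
  {y : EuclideanSpace ℝ (Fin n)}

theorem clarkeDeriv_nonneg_of_mem_zeroLieSet (hV : LocallyLipschitz V)
    (hy : y ∈ zeroLieSet Z f V) : 0 ≤ clarkeDeriv V y (f y) := by
  obtain ⟨η, hη, h0⟩ := hy
  exact h0 ▸ inner_le_clarkeDeriv hV hη (f y)

/-- Off the zero set of the Lie derivative, the generalized derivative along `f` is negative and
bounded by any nonpositive bound of the Lie derivative. -/
theorem clarkeDeriv_neg_of_notMem_zeroLieSet (hV : LocallyLipschitz V) (hZ : volume Z = 0)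
    (hy : y ∉ zeroLieSet Z f V) {b : ℝ} (hb : 0 ≤ b)
    (hdecr : ∀ a ∈ setLieDeriv Z f V y, a ≤ -b) :
    clarkeDeriv V y (f y) < 0 ∧ clarkeDeriv V y (f y) ≤ -b := by
  obtain ⟨η, hη, hle⟩ := exists_clarkeDeriv_le_inner hV hZ y (f y)
  have hb' := hdecr _ ⟨η, hη, rfl⟩
  refine ⟨hle.trans_lt ((hb'.trans (neg_nonpos.2 hb)).lt_of_ne fun h0 => hy ⟨η, hη, h0⟩),
    hle.trans hb'⟩

/-- The left derivative of `V` along trajectories is nonpositive. -/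
theorem clarkeDeriv_neg_vector_nonneg (hV : LocallyLipschitz V) (hZ : volume Z = 0)
    (hdecr : y ∉ zeroLieSet Z f V → ∀ a ∈ setLieDeriv Z f V y, a ≤ 0) :
    0 ≤ clarkeDeriv V y (-f y) := by
  -- One `η` with nonpositive pairing suffices, since `V°(y; -f y)` dominates `-⟪η, f y⟫`.
  obtain ⟨η, hη, hle⟩ : ∃ η ∈ generalizedGradient Z V y, inner ℝ η (f y) ≤ (0 : ℝ) := by
    by_cases hy : y ∈ zeroLieSet Z f V
    · obtain ⟨η, hη, h0⟩ := hy
      exact ⟨η, hη, h0.le⟩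
    · obtain ⟨η, hη, -⟩ := exists_clarkeDeriv_le_inner hV hZ y (f y)
      exact ⟨η, hη, hdecr hy _ ⟨η, hη, rfl⟩⟩
  have := inner_le_clarkeDeriv hV hη (-f y)
  rw [inner_neg_right] at this
  linarith

/-- If the generalized derivative along `f` is negative off the zero set of the Lie derivative,
then this set is closed. -/
theorem isClosed_zeroLieSet (hf : Continuous f) (hV : LocallyLipschitz V)
    (hneg : ∀ y ∉ zeroLieSet Z f V, clarkeDeriv V y (f y) < 0) :
    IsClosed (zeroLieSet Z f V) := by
  rw [← isOpen_compl_iff, isOpen_iff_mem_nhds]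
  intro y hy
  have hpair : Tendsto (fun z => (z, f z)) (𝓝 y) (𝓝 (y, f y)) :=
    (continuous_id.prodMk hf).tendsto y
  filter_upwards [hpair.eventually (eventually_clarkeDeriv_lt hV (hneg y hy))] with z hz hzM
  exact absurd (clarkeDeriv_nonneg_of_mem_zeroLieSet hV hzM) (not_le.2 hz)

/-- `V` is nonincreasing along trajectories. -/
theorem IsSolution.antitoneOn (hx : IsSolution f x) (hV : LocallyLipschitz V)
    (hreg : IsRegular V) (hleft : ∀ y, 0 ≤ clarkeDeriv V y (-f y)) :
    AntitoneOn (fun t => V (x t)) (Ici 0) := by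
  intro a ha b _ hab
  have ha' : 0 ≤ a := ha
  refine le_of_left_deriv_nonpos (W := fun t => V (x t))
    (q := fun t => -clarkeDeriv V (x t) (-f (x t))) hab ?_ ?_ ?_
  · exact hV.continuous.comp_continuousOn (hx.continuousOn.mono fun t ht => ha'.trans ht.1)
  · exact fun t ht =>
      hreg.hasDerivWithinAt_Iic_comp hV (hx.hasDerivWithinAt_Iic (ha'.trans_lt ht.1))
  · exact fun t _ => neg_nonpos.2 (hleft _)

end LaSalle

/-! ### The finite-time invariance theorem. -/

theorem mainTheorem1 (n : ℕ)
    (f : EuclideanSpace ℝ (Fin n) → EuclideanSpace ℝ (Fin n))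
    (hf : Continuous f) (hsol : LaSalle.HasUniqueSolutions f)
    (Z : Set (EuclideanSpace ℝ (Fin n))) (hZ : volume Z = 0)
    (V : EuclideanSpace ℝ (Fin n) → ℝ)
    (hVlip : LocallyLipschitz V) (hVreg : LaSalle.IsRegular V)
    (hVcpt : ∀ c : ℝ, IsCompact {x | V x ≤ c})
    (φ : ℝ → ℝ) (hφmono : Monotone φ) (hφcont : Continuous φ)
    (hφsign : ∀ r, r ≠ 0 → 0 < r * φ r) (hφ0 : φ 0 = 0)
    (hφint : ∀ V₀ : ℝ, IntervalIntegrable (fun r => 1 / φ r) volume 0 V₀)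
    (hVnonneg : ∀ x, x ∉ LaSalle.zeroLieSet Z f V → 0 ≤ V x)
    (hdecr : ∀ x, x ∉ LaSalle.zeroLieSet Z f V →
      ∀ a ∈ LaSalle.setLieDeriv Z f V x, a ≤ -φ (V x)) :
    (∀ x₀, 0 < V x₀ →
      LaSalle.IsInvariant f {y | V y ≤ V x₀} ∧
      ∀ x, LaSalle.IsSolution f x → x 0 = x₀ →
        LaSalle.SettlesWithin x
          (LaSalle.largestInvariantSubset f (LaSalle.zeroLieSet Z f V ∩ {y | V y ≤ V x₀}))
          (∫ r in (0 : ℝ)..V x₀, 1 / φ r)) ∧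
    (LaSalle.RadiallyUnboundedWrt V (LaSalle.zeroLieSet Z f V) →
      ∀ T_M : ℝ, IsLUB (Set.range fun V₀ : ℝ => ∫ r in (0 : ℝ)..V₀, 1 / φ r) T_M →
      ∀ x₀, LaSalle.IsInvariant f {y | V y ≤ V x₀} ∧
        ∀ x, LaSalle.IsSolution f x → x 0 = x₀ →
          LaSalle.SettlesWithin x
            (LaSalle.largestInvariantSubset f (LaSalle.zeroLieSet Z f V ∩ {y | V y ≤ V x₀}))
            T_M) := by
  have hφnonneg : ∀ y ∉ LaSalle.zeroLieSet Z f V, 0 ≤ φ (V y) := fun y hy =>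
    hφ0 ▸ hφmono (hVnonneg y hy)
  have hout : ∀ y ∉ LaSalle.zeroLieSet Z f V, LaSalle.clarkeDeriv V y (f y) < 0 ∧
      LaSalle.clarkeDeriv V y (f y) ≤ -φ (V y) := fun y hy =>
    LaSalle.clarkeDeriv_neg_of_notMem_zeroLieSet hVlip hZ hy (hφnonneg y hy) (hdecr y hy)
  have hleft : ∀ y, 0 ≤ LaSalle.clarkeDeriv V y (-f y) := fun y =>
    LaSalle.clarkeDeriv_neg_vector_nonneg hVlip hZ fun hy a ha =>
      (hdecr y hy a ha).trans (neg_nonpos.2 (hφnonneg y hy))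
  have hclosed : IsClosed (LaSalle.zeroLieSet Z f V) :=
    LaSalle.isClosed_zeroLieSet hf hVlip fun y hy => (hout y hy).1
  have hanti {x : ℝ → EuclideanSpace ℝ (Fin n)} (hx : LaSalle.IsSolution f x) :
      AntitoneOn (fun t => V (x t)) (Ici 0) := hx.antitoneOn hVlip hVreg hleft
  have hinv : ∀ x₀, LaSalle.IsInvariant f {y | V y ≤ V x₀} := fun x₀ x hx h0 t ht =>
    (hanti hx self_mem_Ici (mem_Ici.2 ht) ht).trans h0
  have hsettle : ∀ x₀ x, LaSalle.IsSolution f x → x 0 = x₀ →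
      LaSalle.SettlesWithin x
        (LaSalle.largestInvariantSubset f (LaSalle.zeroLieSet Z f V ∩ {y | V y ≤ V x₀}))
        (∫ r in (0 : ℝ)..V x₀, 1 / φ r) := by
    rintro _ x hx rfl
    obtain ⟨T, hT, hTle, hTM⟩ := LaSalle.exists_settling_time (W := fun t => V (x t))
      (p := fun t => LaSalle.clarkeDeriv V (x t) (f (x t)))
      (A := Ici 0 ∩ x ⁻¹' LaSalle.zeroLieSet Z f V) hφmono hφcont hφsign hφ0 hφint (hanti hx)
      (hVlip.continuous.comp_continuousOn hx.continuousOn)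
      (fun t ht => hVreg.hasDerivWithinAt_Ici_comp hVlip
        ((hx t ht).mono (Ici_subset_Ici.2 ht)))
      (fun t ht => LaSalle.clarkeDeriv_nonneg_of_mem_zeroLieSet hVlip ht.2)
      inter_subset_left (hx.continuousOn.preimage_isClosed_of_isClosed isClosed_Ici hclosed)
      (fun t ht htA => (hout _ fun h => htA ⟨ht, h⟩).1)
      (fun t ht htA => (hout _ fun h => htA ⟨ht, h⟩).2)
      (fun t ht htA => hVnonneg _ fun h => htA ⟨ht, h⟩)
    refine ⟨T, hT, hTle, fun t ht => hx.mem_largestInvariantSubset hsol hT (fun s hs => ?_) ht⟩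
    exact ⟨(hTM s hs).2, hinv (x 0) x hx (mem_ofPred.2 le_rfl) s (hT.trans hs)⟩
  -- The settling bound holds for every `x₀`, whatever the sign of `V x₀`; the second claim replaces
  -- it by the supremum `T_M`.
  refine ⟨fun x₀ _ => ⟨hinv x₀, hsettle x₀⟩, fun _ T_M hT_M x₀ => ⟨hinv x₀, fun x hx h0 => ?_⟩⟩
  obtain ⟨T, hT, hTle, hTE⟩ := hsettle x₀ x hx h0
  exact ⟨T, hT, hTle.trans (hT_M.1 (mem_range_self (V x₀))), hTE⟩
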